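/- Let $\ell\ge 2$, $d_0,\dots,d_\ell\ge 0$ and $m\ge 0$ be integers, $X\in\mathbb R^{d_0\times m}$, $Y\in\mathbb R^{d_\ell\times m}$. For weights $A=(A_1,\dots,A_\ell)$ with $A_k\in\mathbb R^{d_k\times d_{k-1}}$ put $A_{(i,j)}=A_iA_{i-1}\cdots A_j$ (with $A_{(0,1)}=I$) and $$\mathcal L_D(A)=\tfrac12\|A_\ell\cdots A_2A_1X-Y\|_F^2 .$$ A critical point is an $A$ with $\nabla_{A_k}\mathcal L_D(A)=0$ for all $k=1,\dots,\ell$; a saddle point is a critical point that is neither a local minimum nor a local maximum. For $0\le k\le \ell-2$ let $\Sigma_k=Y(A_{(k,1)}X)^\dagger A_{(k,1)}X\,Y^{\top}$, where $\dagger$ is the Moore–Penrose inverse, and let $\sigma_1(k)>\dots>\sigma_{r(k)}(k)>0$ be the distinct positive singular values (equivalently, eigenvalues) of the positive semidefinite matrix $\Sigma_k$. Let $E_i(k)$ be the eigenspace of $\Sigma_k$ for $\sigma_i(k)$, and put $$m_i(k)=\dim E_i(k),\qquad p_i(k)=\dim\bigl(\operatorname{col}(A_{(\ell,k+2)})\cap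 E_i(k)\bigr).$$ (If $A_{(\ell,k+2)}=U_kV_kC_k$ with $U_k$ orthogonal and diagonalizing $\Sigma_k$ with eigenvalues in decreasing order, $C_k$ invertible and $V_k=[\operatorname{diag}(V_1^{(k)},\dots,V_{r(k)}^{(k)},\overline V^{(k)}),0]$ with blocks that have orthonormal columns, the block $V_i^{(k)}$ having $m_i(k)$ rows, then $p_i(k)$ is the number of columns of $V_i^{(k)}$.) A critical point $A$ is of deep-non-optimal order at $k$, where $0\le k\le\ell-2$, if there are $1\le i<j\le r(k)$ with $p_i(k)<m_i(k)$ and $p_j(k)>0$; it is of deep-non-optimal order if this holds for some such $k$. A critical point $A$ is of deep-optimal order if $(A_{\ell-1},A_\ell)$ is not a global minimizer of $\mathcal L_D$ with $A_1,\dots,A_{\ell-2}$ held fixed, $\operatorname{rank}A_\ell<\min\{d_\ell,d_{\ell-1}\}$, and, for some $1\le t\le r(\ell-2)$, $p_i(\ell-2)=m_i(\ell-2)$ for all $i<t$ and $p_t(\ell-2)=\operatorname{rank}A_\ell-\sum_{i<t}m_i(\ell-2)\le m_t(\ell-2)$. Then: 1. If $A$ is a critical point of deep-non-optimal order at $k$,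 then every neighborhood of $A$ contains a point $\widetilde A$ that differs from $A$ at most in the layers $A_{k+1}$ and $A_\ell$, with $\operatorname{rank}\widetilde A_\ell=\operatorname{rank}A_\ell$ and $\mathcal L_D(\widetilde A)<\mathcal L_D(A)$. 2. If $A$ is a critical point of deep-optimal order, then every neighborhood of $A$ contains a point $\widetilde A$ that differs from $A$ at most in the layers $A_{\ell-1}$ and $A_\ell$, with $\operatorname{rank}\widetilde A_\ell=\operatorname{rank}A_\ell+1$ and $\mathcal L_D(\widetilde A)<\mathcal L_D(A)$. 3. If $A$ is any point with $A_{(\ell,1)}X\neq0$, then every neighborhood of $A$ contains a point $\widetilde A$ that differs from $A$ only in the layer $A_\ell$, with $\mathcal L_D(\widetilde A)>\mathcal L_D(A)$. Consequently: every local minimum of $\mathcal L_D$ among the critical points of the two types is a global minimum; and every critical point of the two types with $A_{(\ell,1)}X\ne0$ is a saddle point. -/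

import Mathlib

open Matrix Topology

/-! ### Moore–Penrose inverse of a real matrix -/

/-- `P` is the Moore–Penrose inverse of `M` (the four Penrose equations). -/
structure IsMoorePenrose {a b : Type*} [Fintype a] [Fintype b]
    (M : Matrix a b ℝ) (P : Matrix b a ℝ) : Prop where
  mul_mul_self : M * P * M = M
  self_mul_mul : P * M * P = P
  symm_left : (M * P)ᵀ = M * P
  symm_right : (P * M)ᵀ = P * M

theorem exists_isMoorePenrose {a b : Type*} [Fintype a] [Fintype b]
    (M : Matrix a b ℝ) : ∃ P : Matrix b a ℝ, IsMoorePenrose M P := by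
  classical
  have hG : (Mᵀ * M).IsHermitian := by
    simp [Matrix.IsHermitian, Matrix.conjTranspose_eq_transpose_of_trivial]
  set U : Matrix b b ℝ := (hG.eigenvectorUnitary : Matrix b b ℝ) with hU
  set l : b → ℝ := hG.eigenvalues with hl
  have hUU : U * Uᵀ = 1 := by
    have := (Matrix.mem_unitaryGroup_iff).1 hG.eigenvectorUnitary.2
    simpa [Matrix.star_eq_conjTranspose, Matrix.conjTranspose_eq_transpose_of_trivial] using this
  have hUU' : Uᵀ * U = 1 := by
    have := (Matrix.mem_unitaryGroup_iff').1 hG.eigenvectorUnitary.2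
    simpa [Matrix.star_eq_conjTranspose, Matrix.conjTranspose_eq_transpose_of_trivial] using this
  have hspec : Mᵀ * M = U * diagonal l * Uᵀ := by
    have := hG.spectral_theorem
    rw [Unitary.conjStarAlgAut_apply] at this
    simpa [Matrix.star_eq_conjTranspose, Matrix.conjTranspose_eq_transpose_of_trivial,
      Function.comp_def] using this
  set N : Matrix a b ℝ := M * U with hN
  have hM : M = N * Uᵀ := by rw [hN, Matrix.mul_assoc, hUU, Matrix.mul_one]
  have hNN : Nᵀ * N = diagonal l := by
    rw [hN, Matrix.transpose_mul, Matrix.mul_assoc, ← Matrix.mul_assoc Mᵀ, hspec,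
      Matrix.mul_assoc (U * diagonal l), hUU', Matrix.mul_one, ← Matrix.mul_assoc, hUU',
      Matrix.one_mul]
  have hNl : N * (diagonal (fun i => (l i)⁻¹) * diagonal l) = N := by
    ext x i
    rw [Matrix.diagonal_mul_diagonal, Matrix.mul_diagonal]
    by_cases h : l i = 0
    · have h0 : (Nᵀ * N) i i = 0 := by rw [hNN]; simp [h]
      rw [Matrix.mul_apply] at h0
      have h1 := (Finset.sum_eq_zero_iff_of_nonneg
        (fun j _ => by simpa using mul_self_nonneg (N j i))).1 h0 x (Finset.mem_univ _)
      have h2 : N x i = 0 := by simpa using h1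
      simp [h2]
    · simp [h]
  refine ⟨U * diagonal (fun i => (l i)⁻¹) * Nᵀ, ?_, ?_, ?_, ?_⟩
  · calc M * (U * diagonal (fun i => (l i)⁻¹) * Nᵀ) * M
        = N * diagonal (fun i => (l i)⁻¹) * (Nᵀ * N) * Uᵀ := by
          conv_lhs => rw [hM]
          simp only [Matrix.mul_assoc]
          rw [← Matrix.mul_assoc Uᵀ U, hUU', Matrix.one_mul]
      _ = M := by
          rw [hNN, Matrix.mul_assoc N, hNl, ← hM]
  · calc U * diagonal (fun i => (l i)⁻¹) * Nᵀ * M * (U * diagonal (fun i => (l i)⁻¹) * Nᵀ)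
        = U * diagonal (fun i => (l i)⁻¹) * (Nᵀ * N) * diagonal (fun i => (l i)⁻¹) * Nᵀ := by
          conv_lhs => rw [hM]
          simp only [Matrix.mul_assoc]
          rw [← Matrix.mul_assoc Uᵀ U, hUU', Matrix.one_mul]
      _ = U * diagonal (fun i => (l i)⁻¹) * Nᵀ := by
          rw [hNN, Matrix.mul_assoc U, Matrix.diagonal_mul_diagonal, Matrix.mul_assoc U,
            Matrix.diagonal_mul_diagonal]
          congr 3
          ext i
          by_cases h : l i = 0 <;> simp [h]
  · have : M * (U * diagonal (fun i => (l i)⁻¹) * Nᵀ)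
        = N * diagonal (fun i => (l i)⁻¹) * Nᵀ := by
      rw [hN]; simp only [Matrix.mul_assoc]
    rw [this]
    simp [Matrix.transpose_mul, Matrix.mul_assoc]
  · have : U * diagonal (fun i => (l i)⁻¹) * Nᵀ * M
        = U * (diagonal (fun i => (l i)⁻¹) * diagonal l) * Uᵀ := by
      conv_lhs => rw [hM]
      rw [← hNN]; simp only [Matrix.mul_assoc]
    rw [this, Matrix.diagonal_mul_diagonal]
    simp [Matrix.transpose_mul, Matrix.mul_assoc]

/-- The Moore–Penrose inverse `M†`. -/
noncomputable def pinv {a b : Type*} [Fintype a] [Fintype b]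
    (M : Matrix a b ℝ) : Matrix b a ℝ :=
  Classical.choose (exists_isMoorePenrose M)

theorem pinv_spec {a b : Type*} [Fintype a] [Fintype b] (M : Matrix a b ℝ) :
    IsMoorePenrose M (pinv M) :=
  Classical.choose_spec (exists_isMoorePenrose M)

/-! ### Deep linear networks

A network with `L` weight layers and widths `d 0, …, d L`.  The weight `A_{i+1}`, of
size `d (i+1) × d i`, is the component `A i`, `i : Fin L`. -/

/-- The weights of a linear network with `L` layers and widths `d 0, …, d L`. -/
abbrev Weights {L : ℕ} (d : Fin (L + 1) → ℕ) : Type :=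
  ∀ i : Fin L, Matrix (Fin (d i.succ)) (Fin (d i.castSucc)) ℝ

/-- The product `A_k ⋯ A_2 A_1` of the first `k` layers (the identity for `k = 0`). -/
def lowerProd {L : ℕ} {d : Fin (L + 1) → ℕ} (A : Weights d) (k : Fin (L + 1)) :
    Matrix (Fin (d k)) (Fin (d 0)) ℝ :=
  Fin.induction (motive := fun k => Matrix (Fin (d k)) (Fin (d 0)) ℝ) 1
    (fun i P => A i * P) k

/-- The product `A_L ⋯ A_{k+2} A_{k+1}` of all but the first `k` layers (the identity for
`k = L`). -/
def upperProd {L : ℕ} {d : Fin (L + 1) → ℕ} (A : Weights d) (k : Fin (L + 1)) :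
    Matrix (Fin (d (Fin.last L))) (Fin (d k)) ℝ :=
  Fin.reverseInduction (motive := fun k => Matrix (Fin (d (Fin.last L))) (Fin (d k)) ℝ) 1
    (fun i P => P * A i) k

theorem lowerProd_zero {L : ℕ} {d : Fin (L + 1) → ℕ} (A : Weights d) : lowerProd A 0 = 1 := rfl

theorem lowerProd_succ {L : ℕ} {d : Fin (L + 1) → ℕ} (A : Weights d) (i : Fin L) :
    lowerProd A i.succ = A i * lowerProd A i.castSucc := rfl

theorem upperProd_last {L : ℕ} {d : Fin (L + 1) → ℕ} (A : Weights d) :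
    upperProd A (Fin.last L) = 1 := by
  simp [upperProd]

theorem upperProd_castSucc {L : ℕ} {d : Fin (L + 1) → ℕ} (A : Weights d) (i : Fin L) :
    upperProd A i.castSucc = upperProd A i.succ * A i := by
  simp [upperProd]

/-- The square loss `½ ‖A_L ⋯ A_1 X - Y‖_F²`. -/
noncomputable def loss {L : ℕ} {d : Fin (L + 1) → ℕ} {m : ℕ}
    (X : Matrix (Fin (d 0)) (Fin m) ℝ) (Y : Matrix (Fin (d (Fin.last L))) (Fin m) ℝ)
    (A : Weights d) : ℝ :=
  (1 / 2) * ∑ i, ∑ j, ((lowerProd A (Fin.last L) * X - Y) i j) ^ 2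

/-- Critical points of the loss: the partial derivative with respect to every entry of every
layer vanishes, i.e. `∇_{A_k} loss = 0` for all `k`. -/
def IsCriticalPoint {L : ℕ} {d : Fin (L + 1) → ℕ} {m : ℕ}
    (X : Matrix (Fin (d 0)) (Fin m) ℝ) (Y : Matrix (Fin (d (Fin.last L))) (Fin m) ℝ)
    (A : Weights d) : Prop :=
  ∀ (k : Fin L) (i : Fin (d k.succ)) (j : Fin (d k.castSucc)),
    HasDerivAt
      (fun t : ℝ => loss X Y (Function.update A k (A k + t • Matrix.single i j (1 : ℝ)))) 0 0

/-- `A` is a saddle point of the loss: a critical point that is neither a local minimum nor a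
local maximum. -/
def IsSaddlePoint {L : ℕ} {d : Fin (L + 1) → ℕ} {m : ℕ}
    (X : Matrix (Fin (d 0)) (Fin m) ℝ) (Y : Matrix (Fin (d (Fin.last L))) (Fin m) ℝ)
    (A : Weights d) : Prop :=
  IsCriticalPoint X Y A ∧ ¬ IsLocalMin (loss X Y) A ∧ ¬ IsLocalMax (loss X Y) A

/-! ### Singular values of `Σ_k` and the numbers `m_i(k)`, `p_i(k)` -/

/-- `Σ_k = Y (A_{(k,1)} X)† A_{(k,1)} X Yᵀ`, where `A_{(k,1)} = A_k ⋯ A_1`. -/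
noncomputable def sigmaMat {L : ℕ} {d : Fin (L + 1) → ℕ} {m : ℕ}
    (X : Matrix (Fin (d 0)) (Fin m) ℝ) (Y : Matrix (Fin (d (Fin.last L))) (Fin m) ℝ)
    (A : Weights d) (k : Fin (L + 1)) :
    Matrix (Fin (d (Fin.last L))) (Fin (d (Fin.last L))) ℝ :=
  Y * pinv (lowerProd A k * X) * (lowerProd A k * X) * Yᵀ

/-- The eigenspace of `S` for `s`. -/
def eigSpace {n : Type*} [Fintype n] [DecidableEq n] (S : Matrix n n ℝ) (s : ℝ) :
    Submodule ℝ (n → ℝ) :=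
  Module.End.eigenspace (Matrix.toLin' S) s

/-- The column space of `W`. -/
def colSpace {n q : Type*} [Fintype q] (W : Matrix n q ℝ) : Submodule ℝ (n → ℝ) :=
  LinearMap.range W.mulVecLin

/-- `σ 0 > σ 1 > ⋯ > σ (r-1) > 0` are the distinct positive singular values of `S`; here `S` is
always symmetric positive semidefinite, so that they are its distinct positive eigenvalues. -/
structure IsPosSingularValues {n : Type*} [Fintype n] [DecidableEq n] (S : Matrix n n ℝ)
    {r : ℕ} (σ : Fin r → ℝ) : Prop where
  strictAnti : StrictAnti σ
  mem_iff : ∀ s : ℝ, (∃ i, σ i = s) ↔ 0 < s ∧ Module.End.HasEigenvalue (Matrix.toLin' S) s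

/-- The multiplicity of `s` as a singular value of `S`. -/
noncomputable def multOf {n : Type*} [Fintype n] [DecidableEq n] (S : Matrix n n ℝ) (s : ℝ) : ℕ :=
  Module.finrank ℝ (eigSpace S s)

/-- How many of the singular values `s` of `S` are captured by `W`.  If `W = U V C` with
`V = [diag (V_1, …, V_r, V̄), 0]` a block matrix as in `BlockFactorization` below, this is the
number of columns of the block `V_i` that belongs to `s`: see `BlockFactorization.captured_eq`. -/
noncomputable def captured {n q : Type*} [Fintype n] [DecidableEq n] [Fintype q]
    (S : Matrix n n ℝ) (W : Matrix n q ℝ) (s : ℝ) : ℕ :=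
  Module.finrank ℝ (colSpace W ⊓ eigSpace S s : Submodule ℝ (n → ℝ))

/-- A factorization `W = U V C`, where `S = U diag (σ_1 I_{m_1}, …, σ_r I_{m_r}, 0) Uᵀ` is a full
singular value decomposition with distinct `σ_1 > ⋯ > σ_r > 0` and multiplicities `m_i ≥ 1`,
`V = [diag (V_1, …, V_r, V̄), 0]` with blocks `V_i` of size `m_i × p_i` that have orthonormal
columns, and `C` is invertible. -/
structure BlockFactorization {n q : Type*} [Fintype n] [DecidableEq n] [Fintype q] [DecidableEq q]
    (S : Matrix n n ℝ) (W : Matrix n q ℝ) where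
  r : ℕ
  σ : Fin r → ℝ
  m : Fin r → ℕ
  mbar : ℕ
  p : Fin r → ℕ
  pbar : ℕ
  z : ℕ
  strictAnti : StrictAnti σ
  σ_pos : ∀ i, 0 < σ i
  m_pos : ∀ i, 0 < m i
  U : Matrix n ((Σ i, Fin (m i)) ⊕ Fin mbar) ℝ
  U_mul : U * Uᵀ = 1
  mul_U : Uᵀ * U = 1
  svd : S = U * (diagonal (Sum.elim (fun a => σ a.1) (fun _ => 0)) :
    Matrix ((Σ i, Fin (m i)) ⊕ Fin mbar) ((Σ i, Fin (m i)) ⊕ Fin mbar) ℝ) * Uᵀ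
  V : ∀ i, Matrix (Fin (m i)) (Fin (p i)) ℝ
  V_orth : ∀ i, (V i)ᵀ * V i = 1
  Vbar : Matrix (Fin mbar) (Fin pbar) ℝ
  Vbar_orth : Vbarᵀ * Vbar = 1
  C : Matrix (((Σ i, Fin (p i)) ⊕ Fin pbar) ⊕ Fin z) q ℝ
  D : Matrix q (((Σ i, Fin (p i)) ⊕ Fin pbar) ⊕ Fin z) ℝ
  C_mul : C * D = 1
  mul_C : D * C = 1
  factor : W = U * (fromCols (fromBlocks (blockDiagonal' V) 0 0 Vbar) 0 :
    Matrix ((Σ i, Fin (m i)) ⊕ Fin mbar) (((Σ i, Fin (p i)) ⊕ Fin pbar) ⊕ Fin z) ℝ) * C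

namespace BlockFactorization

variable {n q : Type*} [Fintype n] [DecidableEq n] [Fintype q] [DecidableEq q]
  {S : Matrix n n ℝ} {W : Matrix n q ℝ}

theorem mulVec_S (F : BlockFactorization S W) (x : n → ℝ) :
    S *ᵥ x = F.U *ᵥ (diagonal (Sum.elim (fun a : Σ i, Fin (F.m i) => F.σ a.1) (fun _ => 0))
      *ᵥ (F.Uᵀ *ᵥ x)) := by
  have h := congrArg (fun M => M *ᵥ x) F.svd
  simpa only [Matrix.mulVec_mulVec, ← Matrix.mul_assoc] using h

theorem mulVec_W (F : BlockFactorization S W) (w : q → ℝ) :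
    W *ᵥ w = F.U *ᵥ (fromCols (fromBlocks (blockDiagonal' F.V) 0 0 F.Vbar) 0
      *ᵥ (F.C *ᵥ w)) := by
  have h := congrArg (fun M => M *ᵥ w) F.factor
  simpa only [Matrix.mulVec_mulVec, ← Matrix.mul_assoc] using h

theorem captured_eq (F : BlockFactorization S W) (i : Fin F.r) :
    captured S W (F.σ i) = F.p i := by
  classical
  -- the full block matrix and its action
  let VV := fromCols (fromBlocks (blockDiagonal' F.V) 0 0 F.Vbar)
    (0 : Matrix ((Σ i, Fin (F.m i)) ⊕ Fin F.mbar) (Fin F.z) ℝ)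
  have hVl : ∀ w i' (a : Fin (F.m i')), (VV *ᵥ w) (Sum.inl ⟨i', a⟩)
      = (F.V i' *ᵥ fun b => w (Sum.inl (Sum.inl ⟨i', b⟩))) a := by
    intro w i' a
    simp only [VV, Matrix.mulVec, dotProduct, Fintype.sum_sum_type, Fintype.sum_sigma,
      fromCols_apply_inl, fromCols_apply_inr, fromBlocks_apply₁₁, fromBlocks_apply₁₂,
      Matrix.zero_apply, zero_mul, Finset.sum_const_zero, add_zero]
    rw [Finset.sum_eq_single i']
    · simp [blockDiagonal'_apply_eq]
    · intro j _ hj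
      simp [blockDiagonal'_apply_ne _ _ _ (Ne.symm hj)]
    · simp
  have hVr : ∀ w (a : Fin F.mbar), (VV *ᵥ w) (Sum.inr a)
      = (F.Vbar *ᵥ fun b => w (Sum.inl (Sum.inr b))) a := by
    intro w a
    simp [VV, Matrix.mulVec, dotProduct, Fintype.sum_sum_type]
  let emb : (Fin (F.p i) → ℝ) →ₗ[ℝ] ((((Σ i, Fin (F.p i)) ⊕ Fin F.pbar) ⊕ Fin F.z) → ℝ) :=
    { toFun := fun y => Sum.elim (Sum.elim
        (fun a : Σ i, Fin (F.p i) => (Pi.single i y : ∀ i, Fin (F.p i) → ℝ) a.1 a.2)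
        (fun _ => 0)) (fun _ => 0)
      map_add' := by
        intro x y; ext ((⟨j, b⟩ | b) | b) <;> simp [Pi.single_add]
      map_smul' := by
        intro c y; ext ((⟨j, b⟩ | b) | b) <;> simp [Pi.single_smul] }
  let f : (Fin (F.p i) → ℝ) →ₗ[ℝ] (n → ℝ) := F.U.mulVecLin ∘ₗ VV.mulVecLin ∘ₗ emb
  have hf : ∀ y, f y = F.U *ᵥ (VV *ᵥ emb y) := fun y => rfl
  have hUf : ∀ y, F.Uᵀ *ᵥ f y = VV *ᵥ emb y := by
    intro y; rw [hf, Matrix.mulVec_mulVec, F.mul_U, Matrix.one_mulVec]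
  have hinj : Function.Injective f := by
    intro y y' h
    have h1 : VV *ᵥ emb y = VV *ᵥ emb y' := by rw [← hUf, ← hUf, h]
    have h2 : F.V i *ᵥ y = F.V i *ᵥ y' := by
      ext a
      have := congrFun h1 (Sum.inl ⟨i, a⟩)
      rw [hVl, hVl] at this
      simpa [emb] using this
    have h3 := congrArg (fun v => (F.V i)ᵀ *ᵥ v) h2
    simpa [Matrix.mulVec_mulVec, F.V_orth i] using h3
  have hrange : LinearMap.range f = colSpace W ⊓ eigSpace S (F.σ i) := by
    ext x
    rw [Submodule.mem_inf]
    have hmem : x ∈ eigSpace S (F.σ i) ↔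
        ∀ a, Sum.elim (fun a : Σ i, Fin (F.m i) => F.σ a.1) (fun _ => 0) a * (F.Uᵀ *ᵥ x) a
          = F.σ i * (F.Uᵀ *ᵥ x) a := by
      rw [eigSpace, Module.End.mem_eigenspace_iff, Matrix.toLin'_apply]
      constructor
      · intro h a
        have h1 := congrFun (congrArg (fun v => F.Uᵀ *ᵥ v) h) a
        have h2 : F.Uᵀ *ᵥ (S *ᵥ x)
            = diagonal (Sum.elim (fun a : Σ i, Fin (F.m i) => F.σ a.1) (fun _ => 0))
              *ᵥ (F.Uᵀ *ᵥ x) := by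
          rw [F.mulVec_S, Matrix.mulVec_mulVec, F.mul_U, Matrix.one_mulVec]
        simp only [h2, Matrix.mulVec_diagonal, Matrix.mulVec_smul, Pi.smul_apply,
          smul_eq_mul] at h1
        exact h1
      · intro h
        have h3 : diagonal (Sum.elim (fun a : Σ i, Fin (F.m i) => F.σ a.1)
            (fun _ => 0)) *ᵥ (F.Uᵀ *ᵥ x) = F.σ i • (F.Uᵀ *ᵥ x) := by
          ext a; rw [Matrix.mulVec_diagonal]; exact h a
        rw [F.mulVec_S, h3, Matrix.mulVec_smul, Matrix.mulVec_mulVec, F.U_mul, Matrix.one_mulVec]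
    constructor
    · rintro ⟨y, rfl⟩
      refine ⟨⟨F.D *ᵥ emb y, ?_⟩, hmem.2 ?_⟩
      · rw [Matrix.mulVecLin_apply, F.mulVec_W, Matrix.mulVec_mulVec _ F.C, F.C_mul,
          Matrix.one_mulVec]
        exact (hf y).symm
      · rw [hUf]
        rintro (⟨j, a⟩ | a)
        · by_cases hj : j = i
          · subst hj; rfl
          · have : (VV *ᵥ emb y) (Sum.inl ⟨j, a⟩) = 0 := by
              rw [hVl]; simp [emb, Pi.single_eq_of_ne hj, Matrix.mulVec, dotProduct]
            simp [this]
        · have : (VV *ᵥ emb y) (Sum.inr a) = 0 := by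
            rw [hVr]; simp [emb, Matrix.mulVec, dotProduct]
          simp [this]
    · rintro ⟨⟨w, hw⟩, hE⟩
      rw [Matrix.mulVecLin_apply] at hw
      have hE := hmem.1 hE
      have hx : x = F.U *ᵥ (VV *ᵥ (F.C *ᵥ w)) := by
        rw [← hw, F.mulVec_W]
      have hUx : F.Uᵀ *ᵥ x = VV *ᵥ (F.C *ᵥ w) := by
        rw [hx, Matrix.mulVec_mulVec, F.mul_U, Matrix.one_mulVec]
      refine ⟨fun b => (F.C *ᵥ w) (Sum.inl (Sum.inl ⟨i, b⟩)), ?_⟩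
      rw [hf, hx]
      congr 1
      ext a
      rw [hUx] at hE
      rcases a with ⟨j, a⟩ | a
      · by_cases hj : j = i
        · subst hj; rw [hVl, hVl]; simp [emb]
        · have h1 : (VV *ᵥ (F.C *ᵥ w)) (Sum.inl ⟨j, a⟩) = 0 := by
            by_contra h0
            have := mul_right_cancel₀ h0 (hE (Sum.inl ⟨j, a⟩))
            exact hj (F.strictAnti.injective (by simpa using this))
          rw [h1, hVl]
          simp [emb, Pi.single_eq_of_ne hj, Matrix.mulVec, dotProduct]
      · have h1 : (VV *ᵥ (F.C *ᵥ w)) (Sum.inr a) = 0 := by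
          by_contra h0
          have := mul_right_cancel₀ h0 (hE (Sum.inr a))
          exact (F.σ_pos i).ne (by simpa using this)
        rw [h1, hVr]
        simp [emb, Matrix.mulVec, dotProduct]
  rw [captured, ← hrange, LinearMap.finrank_range_of_inj hinj]
  simp

/-- The factorization `U = U · I · I` of the matrix of singular vectors itself. -/
def full (F : BlockFactorization S W) : BlockFactorization S F.U where
  r := F.r
  σ := F.σ
  m := F.m
  mbar := F.mbar
  p := F.m
  pbar := F.mbar
  z := 0
  strictAnti := F.strictAnti
  σ_pos := F.σ_pos
  m_pos := F.m_pos
  U := F.U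
  U_mul := F.U_mul
  mul_U := F.mul_U
  svd := F.svd
  V := fun _ => 1
  V_orth := by intro i; simp
  Vbar := 1
  Vbar_orth := by simp
  C := fromRows 1 0
  D := fromCols 1 0
  C_mul := by
    ext (a | a) (b | b)
    · simp [Matrix.one_apply]
    · exact b.elim0
    · exact a.elim0
    · exact b.elim0
  mul_C := by simp [fromCols_mul_fromRows]
  factor := by
    have h1 : blockDiagonal' (fun i : Fin F.r => (1 : Matrix (Fin (F.m i)) (Fin (F.m i)) ℝ)) = 1 :=
      blockDiagonal'_one
    rw [h1, fromBlocks_one, Matrix.mul_assoc, fromCols_mul_fromRows]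
    simp

theorem multOf_eq (F : BlockFactorization S W) (i : Fin F.r) :
    multOf S (F.σ i) = F.m i := by
  have h := F.full.captured_eq i
  have htop : colSpace F.U = ⊤ := by
    rw [eq_top_iff]
    intro x _
    exact ⟨F.Uᵀ *ᵥ x, by
      rw [Matrix.mulVecLin_apply, Matrix.mulVec_mulVec, F.U_mul, Matrix.one_mulVec]⟩
  rw [captured, htop, top_inf_eq] at h
  exact h

theorem isPosSingularValues (F : BlockFactorization S W) : IsPosSingularValues S F.σ := by
  refine ⟨F.strictAnti, fun s => ⟨?_, ?_⟩⟩
  · rintro ⟨i, rfl⟩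
    refine ⟨F.σ_pos i, fun h => ?_⟩
    have h1 := F.multOf_eq i
    have h2 : eigSpace S (F.σ i) = ⊥ := h
    rw [multOf, h2, finrank_bot] at h1
    exact (F.m_pos i).ne h1
  · rintro ⟨hs, he⟩
    obtain ⟨x, hx, hx0⟩ := he.exists_hasEigenvector
    rw [Module.End.mem_eigenspace_iff, Matrix.toLin'_apply] at hx
    have h2 : F.Uᵀ *ᵥ (S *ᵥ x)
        = diagonal (Sum.elim (fun a : Σ i, Fin (F.m i) => F.σ a.1) (fun _ => 0))
          *ᵥ (F.Uᵀ *ᵥ x) := by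
      rw [F.mulVec_S, Matrix.mulVec_mulVec, F.mul_U, Matrix.one_mulVec]
    have hne : F.Uᵀ *ᵥ x ≠ 0 := by
      intro h0
      apply hx0
      have := congrArg (fun v => F.U *ᵥ v) h0
      simpa [Matrix.mulVec_mulVec, F.U_mul] using this
    obtain ⟨a, ha⟩ := Function.ne_iff.1 hne
    rw [hx, Matrix.mulVec_smul] at h2
    have h3 := congrFun h2 a
    rw [Matrix.mulVec_diagonal, Pi.smul_apply, smul_eq_mul] at h3
    have h4 := mul_right_cancel₀ ha h3
    rcases a with ⟨j, a⟩ | a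
    · exact ⟨j, by simpa using h4.symm⟩
    · simp at h4; exact absurd h4 hs.ne'

end BlockFactorization

/-! ### The two types of critical points

Networks with `n + 2` layers; the index `k : Fin (n + 1)` runs through `0, …, ℓ - 2`, where
`ℓ = n + 2`.  The last layer `A_ℓ` is `A (Fin.last (n + 1))`, and `A_{k+1}` is `A k.castSucc`.
For such `k`, `m_i(k) = multOf Σ_k σ_i` and `p_i(k) = captured Σ_k (A_ℓ ⋯ A_{k+2}) σ_i`. -/

/-- `A` is a critical point and for the given `k` there are `i < j` with `p_i(k) < m_i(k)` and
`p_j(k) > 0`. -/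
def IsDeepNonOptimalOrderAt {n m : ℕ} {d : Fin (n + 2 + 1) → ℕ}
    (X : Matrix (Fin (d 0)) (Fin m) ℝ) (Y : Matrix (Fin (d (Fin.last (n + 2)))) (Fin m) ℝ)
    (A : Weights d) (k : Fin (n + 1)) : Prop :=
  IsCriticalPoint X Y A ∧
    ∃ (r : ℕ) (σ : Fin r → ℝ),
      IsPosSingularValues (sigmaMat X Y A k.castSucc.castSucc) σ ∧
      ∃ i j : Fin r, i < j ∧
        captured (sigmaMat X Y A k.castSucc.castSucc) (upperProd A k.castSucc.succ) (σ i)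
          < multOf (sigmaMat X Y A k.castSucc.castSucc) (σ i) ∧
        0 < captured (sigmaMat X Y A k.castSucc.castSucc) (upperProd A k.castSucc.succ) (σ j)

/-- Critical points of deep-non-optimal order. -/
def IsDeepNonOptimalOrder {n m : ℕ} {d : Fin (n + 2 + 1) → ℕ}
    (X : Matrix (Fin (d 0)) (Fin m) ℝ) (Y : Matrix (Fin (d (Fin.last (n + 2)))) (Fin m) ℝ)
    (A : Weights d) : Prop :=
  ∃ k : Fin (n + 1), IsDeepNonOptimalOrderAt X Y A k

/-- Critical points of deep-optimal order: `(A_ℓ, A_{ℓ-1})` is not a global minimizer of the loss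
with the other layers fixed, `rank A_ℓ < min (d_ℓ, d_{ℓ-1})`, and for `k = ℓ - 2` and some
`1 ≤ t ≤ r` we have `p_1 = m_1, …, p_{t-1} = m_{t-1}` and
`p_t = rank A_ℓ - (m_1 + ⋯ + m_{t-1}) ≤ m_t`. -/
def IsDeepOptimalOrder {n m : ℕ} {d : Fin (n + 2 + 1) → ℕ}
    (X : Matrix (Fin (d 0)) (Fin m) ℝ) (Y : Matrix (Fin (d (Fin.last (n + 2)))) (Fin m) ℝ)
    (A : Weights d) : Prop :=
  IsCriticalPoint X Y A ∧
    ¬ IsMinOn (loss X Y)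
        {B : Weights d | ∀ i, i ≠ (Fin.last n).castSucc → i ≠ Fin.last (n + 1) → B i = A i} A ∧
    (A (Fin.last (n + 1))).rank
      < min (d (Fin.last (n + 1)).succ) (d (Fin.last (n + 1)).castSucc) ∧
    ∃ (r : ℕ) (σ : Fin r → ℝ),
      IsPosSingularValues (sigmaMat X Y A (Fin.last n).castSucc.castSucc) σ ∧
      ∃ t : Fin r,
        (∀ i < t,
          captured (sigmaMat X Y A (Fin.last n).castSucc.castSucc)
              (upperProd A (Fin.last n).castSucc.succ) (σ i)
            = multOf (sigmaMat X Y A (Fin.last n).castSucc.castSucc) (σ i)) ∧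
        captured (sigmaMat X Y A (Fin.last n).castSucc.castSucc)
            (upperProd A (Fin.last n).castSucc.succ) (σ t)
          + ∑ i ∈ Finset.Iio t, multOf (sigmaMat X Y A (Fin.last n).castSucc.castSucc) (σ i)
          = (A (Fin.last (n + 1))).rank ∧
        captured (sigmaMat X Y A (Fin.last n).castSucc.castSucc)
            (upperProd A (Fin.last n).castSucc.succ) (σ t)
          ≤ multOf (sigmaMat X Y A (Fin.last n).castSucc.castSucc) (σ t)

/-! Fix a layer and write the output as `W P Z`, with `P` that layer, `W` the product of the layers
above it and `Z` the product of those below it, times `X`. Put `T = W W†` and `Q = Z† Z`, both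
orthogonal projections. Stationarity in `P` forces `W P Z = T Y Q` (`IsCriticalPoint.output_eq`), so
the loss is `½ (‖Y‖² - tr (T Σ))` with `Σ = Y Q Yᵀ`. Stationarity in the last layer makes `T`
commute with `Σ` (`IsCriticalPoint.sigmaMat_comm`), so eigenspaces of `Σ` split along `T`.

Non-optimal order then supplies unit eigenvectors `v` in the range of `T` and `u` orthogonal to it,
the eigenvalue of `u` being larger. Replacing `v` by `v + t u` in the range of `T` increases `tr (T
Σ)`. The last layer realizes this through an invertible left factor, which keeps its rank, together
with a correction of `P` (`exists_descent_of_eigenvectors`).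

In the optimal case the last two layers do not minimize the loss, so the residual `E` has `E Zᵀ ≠
0`. A kernel vector `x` of the last layer is unused capacity: it is sent to a nonzero column `u` of
`E Zᵀ`, and the layer before feeds `x`. The descent appears at third order
(`exists_descent_of_rank_lt`).

Ascent comes from scaling the last layer, along which the loss is a strictly convex quadratic
whenever the output is nonzero. -/

/-! ### Frobenius norms, projections and descent for the two-factor problem -/

section MatrixLemmas

variable {a b c m : Type*} [Fintype a] [Fintype b] [Fintype c] [Fintype m]

/-- The squared Frobenius norm. -/
def frobSq (M : Matrix a m ℝ) : ℝ := ∑ i, ∑ j, M i j ^ 2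

theorem frobSq_eq_trace (M : Matrix a m ℝ) : frobSq M = (M * Mᵀ).trace := by
  simp [frobSq, Matrix.trace, Matrix.mul_apply, sq]

theorem frobSq_nonneg (M : Matrix a m ℝ) : 0 ≤ frobSq M :=
  Finset.sum_nonneg fun _ _ => Finset.sum_nonneg fun _ _ => sq_nonneg _

theorem frobSq_pos {M : Matrix a m ℝ} (h : M ≠ 0) : 0 < frobSq M := by
  refine (frobSq_nonneg M).lt_of_ne fun h0 => h ?_
  ext i j
  have h1 := (Finset.sum_eq_zero_iff_of_nonneg
    (fun i _ => Finset.sum_nonneg fun j _ => sq_nonneg (M i j))).1 h0.symm i (Finset.mem_univ _)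
  have h2 := (Finset.sum_eq_zero_iff_of_nonneg
    (fun j _ => sq_nonneg (M i j))).1 h1 j (Finset.mem_univ _)
  simpa using h2

theorem frobSq_add (M N : Matrix a m ℝ) :
    frobSq (M + N) = frobSq M + 2 * (M * Nᵀ).trace + frobSq N := by
  have h : (N * Mᵀ).trace = (M * Nᵀ).trace := by
    rw [← Matrix.trace_transpose, Matrix.transpose_mul, Matrix.transpose_transpose]
  simp only [frobSq_eq_trace, Matrix.transpose_add, Matrix.add_mul, Matrix.mul_add,
    Matrix.trace_add, h]
  ring

theorem frobSq_smul (r : ℝ) (M : Matrix a m ℝ) : frobSq (r • M) = r ^ 2 * frobSq M := by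
  simp [frobSq, mul_pow, Finset.mul_sum]

theorem continuous_frobSq : Continuous (frobSq : Matrix a m ℝ → ℝ) := by
  unfold frobSq
  fun_prop

/-- The residual of a projected right-hand side. -/
theorem frobSq_proj_mul_sub {T : Matrix a a ℝ} {Q : Matrix m m ℝ} (Y : Matrix a m ℝ)
    (hT : Tᵀ = T) (hT2 : T * T = T) (hQ : Qᵀ = Q) (hQ2 : Q * Q = Q) :
    frobSq (T * Y * Q - Y) = frobSq Y - (T * (Y * Q * Yᵀ)).trace := by
  -- `T Y Q` is the orthogonal projection of `Y`, so its inner products with itself and with `Y`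
  -- agree; each is `tr (T Σ)`, by cyclicity of the trace.
  have h1 : (T * Y * Q * (T * Y * Q)ᵀ).trace = (T * (Y * Q * Yᵀ)).trace := by
    have : T * Y * Q * (T * Y * Q)ᵀ = T * (Y * (Q * Q) * Yᵀ) * T := by
      simp only [Matrix.transpose_mul, hT, hQ, Matrix.mul_assoc]
    rw [this, hQ2, Matrix.trace_mul_comm, ← Matrix.mul_assoc, hT2]
  have h2 : (Y * (T * Y * Q)ᵀ).trace = (T * (Y * Q * Yᵀ)).trace := by
    have : Y * (T * Y * Q)ᵀ = (Y * Q * Yᵀ) * T := by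
      simp only [Matrix.transpose_mul, hT, hQ, Matrix.mul_assoc]
    rw [this, Matrix.trace_mul_comm]
  have h3 : (T * Y * Q * Yᵀ).trace = (T * (Y * Q * Yᵀ)).trace := by
    simp only [Matrix.mul_assoc]
  simp only [frobSq_eq_trace, Matrix.transpose_sub, Matrix.sub_mul, Matrix.mul_sub,
    Matrix.trace_sub, h1, h2, h3]
  ring

theorem exists_unit_smul {v : a → ℝ} (hv : v ≠ 0) : ∃ r : ℝ, (r • v) ⬝ᵥ (r • v) = 1 := by
  have h : 0 < v ⬝ᵥ v :=
    (dotProduct_self_star_nonneg (v := v)).lt_of_ne fun h => hv (dotProduct_self_eq_zero.1 h.symm)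
  refine ⟨(Real.sqrt (v ⬝ᵥ v))⁻¹, ?_⟩
  rw [smul_dotProduct, dotProduct_smul, smul_eq_mul, smul_eq_mul, ← mul_assoc, ← mul_inv,
    Real.mul_self_sqrt h.le, inv_mul_cancel₀ h.ne']

/-- Replacing a unit vector `v` in the range of an orthogonal projection `T` by a multiple of a
vector `w` orthogonal to the rest of the range. -/
theorem proj_replace {T : Matrix a a ℝ} {v w : a → ℝ} {s : ℝ} (hT : Tᵀ = T) (hT2 : T * T = T)
    (hv : T *ᵥ v = v) (hvv : v ⬝ᵥ v = 1) (hw : T *ᵥ w = (v ⬝ᵥ w) • v) (hs : s * (w ⬝ᵥ w) = 1) :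
    (T - vecMulVec v v + s • vecMulVec w w)ᵀ = T - vecMulVec v v + s • vecMulVec w w ∧
    (T - vecMulVec v v + s • vecMulVec w w) * (T - vecMulVec v v + s • vecMulVec w w)
      = T - vecMulVec v v + s • vecMulVec w w := by
  have hvT : v ᵥ* T = v := by rw [← hT, Matrix.vecMul_transpose, hv]
  have hwT : w ᵥ* T = (v ⬝ᵥ w) • v := by rw [← hT, Matrix.vecMul_transpose, hw]
  have hwv : w ⬝ᵥ v = v ⬝ᵥ w := dotProduct_comm _ _
  refine ⟨?_, ?_⟩
  · simp [hT, Matrix.transpose_vecMulVec]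
  · have e1 : T * vecMulVec v v = vecMulVec v v := by rw [Matrix.mul_vecMulVec, hv]
    have e2 : vecMulVec v v * T = vecMulVec v v := by rw [Matrix.vecMulVec_mul, hvT]
    have e3 : T * vecMulVec w w = (v ⬝ᵥ w) • vecMulVec v w := by
      rw [Matrix.mul_vecMulVec, hw, Matrix.smul_vecMulVec]
    have e4 : vecMulVec w w * T = (v ⬝ᵥ w) • vecMulVec w v := by
      rw [Matrix.vecMulVec_mul, hwT, Matrix.vecMulVec_smul]
    have e5 : vecMulVec v v * vecMulVec v v = vecMulVec v v := by
      rw [Matrix.vecMulVec_mul_vecMulVec, hvv, one_smul]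
    have e6 : vecMulVec v v * vecMulVec w w = (v ⬝ᵥ w) • vecMulVec v w := by
      rw [Matrix.vecMulVec_mul_vecMulVec, Matrix.vecMulVec_smul]
    have e7 : vecMulVec w w * vecMulVec v v = (v ⬝ᵥ w) • vecMulVec w v := by
      rw [Matrix.vecMulVec_mul_vecMulVec, Matrix.vecMulVec_smul, hwv]
    have e8 : vecMulVec w w * vecMulVec w w = (w ⬝ᵥ w) • vecMulVec w w := by
      rw [Matrix.vecMulVec_mul_vecMulVec, Matrix.vecMulVec_smul]
    simp only [Matrix.add_mul, Matrix.mul_add, Matrix.sub_mul, Matrix.mul_sub, hT2,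
      Matrix.smul_mul, Matrix.mul_smul, e1, e2, e3, e4, e5, e6, e7, e8]
    -- The mixed terms in `v` and `w` cancel; what is left is `s² (w ⬝ᵥ w) w wᵀ = s w wᵀ`.
    linear_combination (norm := module) hs • s • vecMulVec w w

variable [DecidableEq a]

/-- Rotating a singular direction `v` captured by `W` towards a larger one `u` that is missing
decreases the loss of a two-factor problem. -/
theorem exists_descent_of_eigenvectors {W : Matrix a b ℝ} {P : Matrix b c ℝ} {Z : Matrix c m ℝ}
    {Y : Matrix a m ℝ} (hWPZ : W * P * Z = W * pinv W * Y * (pinv Z * Z))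
    {u v : a → ℝ} {σ τ : ℝ} (hστ : τ < σ)
    (huu : u ⬝ᵥ u = 1) (hvv : v ⬝ᵥ v = 1) (hu : (W * pinv W) *ᵥ u = 0)
    (hv : (W * pinv W) *ᵥ v = v)
    (hSu : (Y * pinv Z * Z * Yᵀ) *ᵥ u = σ • u) (hSv : (Y * pinv Z * Z * Yᵀ) *ᵥ v = τ • v) :
    ∃ (R : ℝ → Matrix a a ℝ) (P' : ℝ → Matrix b c ℝ), Continuous R ∧ Continuous P' ∧
      R 0 = 1 ∧ P' 0 = P ∧ (∀ t, IsUnit (R t)) ∧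
      ∀ t ≠ 0, frobSq (R t * W * P' t * Z - Y) < frobSq (W * P * Z - Y) := by
  obtain ⟨hW1, hW2, hW3, hW4⟩ := pinv_spec W
  obtain ⟨hZ1, hZ2, hZ3, hZ4⟩ := pinv_spec Z
  set T := W * pinv W with hTdef
  set Q := pinv Z * Z with hQdef
  have hT2 : T * T = T := by rw [hTdef, ← Matrix.mul_assoc, hW1]
  have hQ2 : Q * Q = Q := by rw [hQdef, ← Matrix.mul_assoc, hZ2]
  have huv : u ⬝ᵥ v = 0 := by
    rw [← hv, Matrix.dotProduct_mulVec, ← hW3, Matrix.vecMul_transpose, hu, zero_dotProduct]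
  have hvu : v ⬝ᵥ u = 0 := by rw [dotProduct_comm, huv]
  have hS : Y * pinv Z * Z * Yᵀ = Y * Q * Yᵀ := by simp only [hQdef, Matrix.mul_assoc]
  rw [hS] at hSu hSv
  have hpos : ∀ t : ℝ, 1 + t ^ 2 ≠ 0 := fun t => by positivity
  -- `w = v + t u` is the rotated direction and `s` is `1 / ‖w‖²`. The left factor `1 + t u vᵀ`
  -- sends `v` to `w`, but its product with `T` is not symmetric; `G` is the correction that
  -- restores an orthogonal projection. Its columns are multiples of `v`, hence in the range of `W`,
  -- so it can be produced by changing `P` alone.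
  let s : ℝ → ℝ := fun t => (1 + t ^ 2)⁻¹
  let w : ℝ → a → ℝ := fun t => v + t • u
  let G : ℝ → Matrix a m ℝ := fun t =>
    (s t • vecMulVec v (w t) - vecMulVec v v) * Y
  have hsc : Continuous s := (by fun_prop : Continuous fun t : ℝ => 1 + t ^ 2).inv₀ hpos
  have hwc : Continuous w := by fun_prop
  have hww : ∀ t, w t ⬝ᵥ w t = 1 + t ^ 2 := fun t => by
    simp [w, huu, hvv, huv, hvu]; ring
  refine ⟨fun t => 1 + t • vecMulVec u v, fun t => P + pinv W * G t * pinv Z, by fun_prop, ?_,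
    by simp, ?_, ?_, ?_⟩
  · have : Continuous fun t => vecMulVec v (w t) := continuous_const.matrix_vecMulVec hwc
    fun_prop
  · simp [G, s, w]
  · intro t
    -- `u vᵀ` squares to zero because `u` and `v` are orthogonal.
    have h1 : (1 + t • vecMulVec u v) * (1 - t • vecMulVec u v) = 1 := by
      simp [Matrix.add_mul, Matrix.mul_sub, Matrix.vecMulVec_mul_vecMulVec, hvu]
    exact IsUnit.of_mul_eq_one _ h1
  · intro t ht
    have hTG : T * G t = G t := by
      simp only [G, ← Matrix.mul_assoc, Matrix.mul_sub, Matrix.mul_smul, Matrix.mul_vecMulVec, hv]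
    have hwT : T *ᵥ w t = (v ⬝ᵥ w t) • v := by
      simp [w, Matrix.mulVec_add, Matrix.mulVec_smul, hu, hv, hvv, hvu]
    obtain ⟨hN, hN2⟩ := proj_replace hW3 hT2 hv hvv hwT
      (s := s t) (by rw [hww]; exact inv_mul_cancel₀ (hpos t))
    set T' := T - vecMulVec v v + s t • vecMulVec (w t) (w t) with hT'
    have hvT : v ᵥ* T = v := by rw [← hW3, Matrix.vecMul_transpose, hv]
    -- The left factor fixes `T - v vᵀ`, whose range is orthogonal to `v`, and turns `s v wᵀ` into
    -- `s w wᵀ`.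
    have h1 : (1 + t • vecMulVec u v) * (T + (s t • vecMulVec v (w t) - vecMulVec v v)) = T' := by
      have e1 : vecMulVec u v * T = vecMulVec u v := by rw [Matrix.vecMulVec_mul, hvT]
      have e2 : vecMulVec u v * vecMulVec v (w t) = vecMulVec u (w t) := by
        rw [Matrix.vecMulVec_mul_vecMulVec, hvv, one_smul]
      have e3 : vecMulVec u v * vecMulVec v v = vecMulVec u v := by
        rw [Matrix.vecMulVec_mul_vecMulVec, hvv, one_smul]
      have e4 : vecMulVec (w t) (w t) = vecMulVec v (w t) + t • vecMulVec u (w t) := by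
        rw [← Matrix.smul_vecMulVec, ← Matrix.add_vecMulVec]
      simp only [hT', Matrix.add_mul, Matrix.mul_add, Matrix.one_mul, Matrix.smul_mul,
        Matrix.mul_sub, Matrix.mul_smul, e1, e2, e3, e4]
      module
    have h2 : (1 + t • vecMulVec u v) * W * (P + pinv W * G t * pinv Z) * Z = T' * Y * Q := by
      have : (1 + t • vecMulVec u v) * W * (P + pinv W * G t * pinv Z) * Z
          = (1 + t • vecMulVec u v) * (W * P * Z + T * G t * Q) := by
        simp only [hTdef, hQdef, Matrix.mul_add, Matrix.add_mul, Matrix.mul_assoc]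
      rw [this, hTG, hWPZ, ← h1]
      simp only [G, Matrix.mul_add, Matrix.add_mul, Matrix.mul_assoc]
    rw [h2, hWPZ, frobSq_proj_mul_sub Y hN hN2 hZ4 hQ2, frobSq_proj_mul_sub Y hW3 hT2 hZ4 hQ2]
    have h3 : (T' * (Y * Q * Yᵀ)).trace
        = (T * (Y * Q * Yᵀ)).trace - τ + s t * (τ + t ^ 2 * σ) := by
      have hvS : ((Y * Q * Yᵀ) * vecMulVec v v).trace = τ := by
        rw [Matrix.mul_vecMulVec, hSv, Matrix.trace_vecMulVec, smul_dotProduct, hvv]; simp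
      have hwS : ((Y * Q * Yᵀ) * vecMulVec (w t) (w t)).trace = τ + t ^ 2 * σ := by
        rw [Matrix.mul_vecMulVec, Matrix.trace_vecMulVec]
        simp only [w, Matrix.mulVec_add, Matrix.mulVec_smul, hSu, hSv]
        simp [huu, hvv, huv, hvu]; ring
      rw [hT', Matrix.add_mul, Matrix.sub_mul, Matrix.trace_add, Matrix.trace_sub,
        Matrix.smul_mul, Matrix.trace_smul, Matrix.trace_mul_comm (vecMulVec v v), hvS,
        Matrix.trace_mul_comm (vecMulVec (w t) (w t)), hwS, smul_eq_mul]
    have h4 : s t * (τ + t ^ 2 * σ) - τ = t ^ 2 * (σ - τ) / (1 + t ^ 2) := by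
      have := hpos t
      simp only [s]; field_simp; ring
    have h5 : 0 < t ^ 2 * (σ - τ) / (1 + t ^ 2) :=
      div_pos (mul_pos (by positivity) (sub_pos.2 hστ)) (by positivity)
    linarith

omit [DecidableEq a] in
/-- A vector orthogonal to the columns of `W` and a vector in the kernel of `W` give a rank-one
update that increases the rank by one. -/
theorem rank_add_smul_vecMulVec {W : Matrix a b ℝ} {u : a → ℝ} {x : b → ℝ} {r : ℝ} (hr : r ≠ 0)
    (hu0 : u ≠ 0) (hx0 : x ≠ 0) (hu : Wᵀ *ᵥ u = 0) (hx : W *ᵥ x = 0) :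
    (W + r • vecMulVec u x).rank = W.rank + 1 := by
  have huu : u ⬝ᵥ u ≠ 0 := fun h => hu0 (dotProduct_self_eq_zero.1 h)
  have hxx : x ⬝ᵥ x ≠ 0 := fun h => hx0 (dotProduct_self_eq_zero.1 h)
  have hWu : ∀ y, u ⬝ᵥ (W *ᵥ y) = 0 := fun y => by
    rw [Matrix.dotProduct_mulVec, ← Matrix.mulVec_transpose, hu, zero_dotProduct]
  have hval : ∀ y, (W + r • vecMulVec u x) *ᵥ y = W *ᵥ y + (r * (x ⬝ᵥ y)) • u := fun y => by
    rw [Matrix.add_mulVec, Matrix.smul_mulVec, Matrix.vecMulVec_mulVec]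
    rw [op_smul_eq_smul, smul_smul]
  have hnot : u ∉ LinearMap.range W.mulVecLin := by
    rintro ⟨y, hy⟩
    have h := hWu y
    rw [Matrix.mulVecLin_apply] at hy
    rw [hy] at h
    exact huu h
  have hrange : LinearMap.range (W + r • vecMulVec u x).mulVecLin
      = LinearMap.range W.mulVecLin ⊔ Submodule.span ℝ {u} := by
    apply le_antisymm
    · rintro _ ⟨y, rfl⟩
      rw [Matrix.mulVecLin_apply, hval]
      exact Submodule.add_mem_sup ⟨y, rfl⟩
        (Submodule.smul_mem _ _ (Submodule.mem_span_singleton_self u))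
    · have hmem : u ∈ LinearMap.range (W + r • vecMulVec u x).mulVecLin := by
        -- Since `W x = 0`, only the rank-one term acts on `x`, and this multiple is sent exactly to
        -- `u`.
        refine ⟨(r * (x ⬝ᵥ x))⁻¹ • x, ?_⟩
        rw [Matrix.mulVecLin_apply, Matrix.mulVec_smul, hval, hx, zero_add, smul_smul,
          inv_mul_cancel₀ (mul_ne_zero hr hxx), one_smul]
      refine sup_le ?_ ((Submodule.span_singleton_le_iff_mem _ _).2 hmem)
      rintro _ ⟨y, rfl⟩
      have h1 : W *ᵥ y = (W + r • vecMulVec u x) *ᵥ y - (r * (x ⬝ᵥ y)) • u := by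
        rw [hval]; simp
      rw [Matrix.mulVecLin_apply, h1]
      exact Submodule.sub_mem _ ⟨y, rfl⟩ (Submodule.smul_mem _ _ hmem)
  rw [Matrix.rank, hrange, Matrix.rank]
  have h := Submodule.finrank_sup_add_finrank_inf_eq (LinearMap.range W.mulVecLin)
    (Submodule.span ℝ {u})
  have hd : LinearMap.range W.mulVecLin ⊓ Submodule.span ℝ {u} = ⊥ := by
    rw [← disjoint_iff]
    exact (Submodule.disjoint_span_singleton' hu0).2 hnot
  rw [hd, finrank_bot, finrank_span_singleton hu0] at h
  simpa using h

omit [DecidableEq a] in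
/-- Away from the minimum of `M ↦ ‖M Z - Y‖`, a rank-deficient left factor can be perturbed, by
one more rank, so that the loss of a two-factor problem decreases. -/
theorem exists_descent_of_rank_lt [DecidableEq c] {W : Matrix a b ℝ} {P : Matrix b c ℝ}
    {Z : Matrix c m ℝ} {Y : Matrix a m ℝ} (hrank : W.rank < Fintype.card b)
    (hP : Wᵀ * (W * P * Z - Y) * Zᵀ = 0) (hW : (W * P * Z - Y) * (P * Z)ᵀ = 0)
    (hne : (W * P * Z - Y) * Zᵀ ≠ 0) :
    ∃ (W' : ℝ → Matrix a b ℝ) (P' : ℝ → Matrix b c ℝ), Continuous W' ∧ Continuous P' ∧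
      W' 0 = W ∧ P' 0 = P ∧ (∀ t ≠ 0, (W' t).rank = W.rank + 1) ∧
      ∀ᶠ t in 𝓝[>] (0 : ℝ), frobSq (W' t * P' t * Z - Y) < frobSq (W * P * Z - Y) := by
  set E := W * P * Z - Y with hE
  obtain ⟨x, hx0, hx⟩ : ∃ x : b → ℝ, x ≠ 0 ∧ W *ᵥ x = 0 := by
    have h := LinearMap.finrank_range_add_finrank_ker W.mulVecLin
    have hk : 0 < Module.finrank ℝ (LinearMap.ker W.mulVecLin) := by
      rw [Module.finrank_fintype_fun_eq_card] at h
      rw [Matrix.rank] at hrank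
      omega
    have := Module.finrank_pos_iff.1 hk
    obtain ⟨⟨x, hx⟩, hx0⟩ := exists_ne (0 : LinearMap.ker W.mulVecLin)
    exact ⟨x, fun h => hx0 (Subtype.ext h), by simpa using hx⟩
  obtain ⟨j, hj⟩ : ∃ j, (E * Zᵀ).col j ≠ 0 := by
    by_contra! h
    exact hne (by ext i j; exact congrFun (h j) i)
  set u := (E * Zᵀ).col j with hu
  have huE : (E * Zᵀ) *ᵥ Pi.single j 1 = u := by simp [hu]
  have hWu : Wᵀ *ᵥ u = 0 := by
    rw [← huE, Matrix.mulVec_mulVec, ← Matrix.mul_assoc, hP, Matrix.zero_mulVec]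
  have huu : 0 < u ⬝ᵥ u :=
    (dotProduct_self_star_nonneg (v := u)).lt_of_ne fun h => hj (dotProduct_self_eq_zero.1 h.symm)
  have hxx : 0 < x ⬝ᵥ x :=
    (dotProduct_self_star_nonneg (v := x)).lt_of_ne fun h => hx0 (dotProduct_self_eq_zero.1 h.symm)
  let e : c → ℝ := Pi.single j 1
  -- Unequal powers of `t` are essential. The product changes by `t² u xᵀ P - t³ ‖x‖² u eᵀ`, the
  -- order `t` term dying with `W x = 0`. The `t²` term is orthogonal to the residual by `hW`, so
  -- the linear gain has order `t³` and beats the quadratic cost of order `t⁴`. With equal powers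
  -- both would have order `t²`.
  refine ⟨fun t => W + t ^ 2 • vecMulVec u x, fun t => P - t • vecMulVec x e, by fun_prop,
    by fun_prop, by simp, by simp, fun t ht =>
      rank_add_smul_vecMulVec (pow_ne_zero 2 ht) hj hx0 hWu hx, ?_⟩
  let K : ℝ → Matrix a m ℝ := fun t => vecMulVec u x * P * Z - (t * (x ⬝ᵥ x)) • (vecMulVec u e * Z)
  have hval : ∀ t : ℝ, (W + t ^ 2 • vecMulVec u x) * (P - t • vecMulVec x e) * Z - Y
      = E + t ^ 2 • K t := by
    intro t
    have e1 : W * vecMulVec x e = 0 := by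
      rw [Matrix.mul_vecMulVec, hx, Matrix.zero_vecMulVec]
    have e2 : vecMulVec u x * vecMulVec x e = (x ⬝ᵥ x) • vecMulVec u e := by
      rw [Matrix.vecMulVec_mul_vecMulVec, Matrix.vecMulVec_smul]
    simp only [hE, K, Matrix.add_mul, Matrix.mul_sub, Matrix.sub_mul, Matrix.smul_mul,
      Matrix.mul_smul, e1, e2, Matrix.zero_mul]
    module
  have htr : ∀ t, (E * (K t)ᵀ).trace = -(t * (x ⬝ᵥ x) * (u ⬝ᵥ u)) := by
    intro t
    have h1 : E * (vecMulVec u x * P * Z)ᵀ = 0 := by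
      have : E * (vecMulVec u x * P * Z)ᵀ = E * (P * Z)ᵀ * (vecMulVec u x)ᵀ := by
        simp only [Matrix.transpose_mul, Matrix.mul_assoc]
      rw [this, hW, Matrix.zero_mul]
    have h2 : (E * (vecMulVec u e * Z)ᵀ).trace = u ⬝ᵥ u := by
      rw [Matrix.transpose_mul, ← Matrix.mul_assoc, Matrix.transpose_vecMulVec,
        Matrix.mul_vecMulVec, huE, Matrix.trace_vecMulVec]
    simp only [K, Matrix.transpose_sub, Matrix.mul_sub, h1, Matrix.transpose_smul,
      Matrix.mul_smul, Matrix.trace_sub, Matrix.trace_smul, h2, Matrix.trace_zero]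
    simp
  have hKc : Continuous fun t => t * frobSq (K t) :=
    continuous_id.mul (continuous_frobSq.comp (by fun_prop))
  have hev : ∀ᶠ t in 𝓝 (0 : ℝ), t * frobSq (K t) < 2 * ((x ⬝ᵥ x) * (u ⬝ᵥ u)) :=
    hKc.continuousAt.eventually_lt continuousAt_const (by simpa using mul_pos hxx huu)
  filter_upwards [hev.filter_mono nhdsWithin_le_nhds, self_mem_nhdsWithin] with t ht ht0
  have ht0 : 0 < t := ht0
  rw [hval, frobSq_add, frobSq_smul, Matrix.transpose_smul, Matrix.mul_smul, Matrix.trace_smul,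
    htr, smul_eq_mul]
  -- Twice the decrease `t³ ‖x‖² ‖u‖²` exceeds `t⁴ ‖K t‖²`; the odd power is why `t` must be
  -- positive.
  nlinarith [mul_pos (pow_pos ht0 3) (sub_pos.2 ht)]

end MatrixLemmas

/-! ### Layer products and stationarity in one layer -/

section Network

variable {L m : ℕ} {d : Fin (L + 1) → ℕ}

theorem loss_eq_frobSq (X : Matrix (Fin (d 0)) (Fin m) ℝ)
    (Y : Matrix (Fin (d (Fin.last L))) (Fin m) ℝ) (A : Weights d) :
    loss X Y A = 1 / 2 * frobSq (lowerProd A (Fin.last L) * X - Y) := rfl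

theorem lowerProd_congr {A B : Weights d} (k : Fin (L + 1))
    (h : ∀ i : Fin L, i.castSucc < k → B i = A i) : lowerProd B k = lowerProd A k := by
  induction k using Fin.induction with
  | zero => rfl
  | succ i ih =>
    rw [lowerProd_succ, lowerProd_succ, h i Fin.castSucc_lt_succ,
      ih fun j hj => h j (hj.trans Fin.castSucc_lt_succ)]

theorem upperProd_congr {A B : Weights d} (k : Fin (L + 1))
    (h : ∀ i : Fin L, k ≤ i.castSucc → B i = A i) : upperProd B k = upperProd A k := by
  induction k using Fin.reverseInduction with
  | last => rw [upperProd_last, upperProd_last]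
  | cast i ih =>
    rw [upperProd_castSucc, upperProd_castSucc, h i le_rfl,
      ih fun j hj => h j (Fin.castSucc_lt_succ.le.trans hj)]

theorem upperProd_mul_lowerProd (A : Weights d) (k : Fin (L + 1)) :
    upperProd A k * lowerProd A k = lowerProd A (Fin.last L) := by
  induction k using Fin.reverseInduction with
  | last => rw [upperProd_last, Matrix.one_mul]
  | cast i ih => rw [upperProd_castSucc, Matrix.mul_assoc, ← lowerProd_succ, ih]

/-- Isolates one layer between factors that do not involve it, so the output is linear in that
layer. -/
theorem lowerProd_last_eq (A : Weights d) (k : Fin L) :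
    lowerProd A (Fin.last L) = upperProd A k.succ * A k * lowerProd A k.castSucc := by
  rw [← upperProd_mul_lowerProd A k.succ, lowerProd_succ, Matrix.mul_assoc]

/-- The stationarity equation of a single layer. -/
theorem IsCriticalPoint.gradient_eq_zero {X : Matrix (Fin (d 0)) (Fin m) ℝ}
    {Y : Matrix (Fin (d (Fin.last L))) (Fin m) ℝ} {A : Weights d} (hA : IsCriticalPoint X Y A)
    (k : Fin L) :
    (upperProd A k.succ)ᵀ * (lowerProd A (Fin.last L) * X - Y)
      * (lowerProd A k.castSucc * X)ᵀ = 0 := by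
  set E := lowerProd A (Fin.last L) * X - Y with hE
  set U := upperProd A k.succ with hU
  set V := lowerProd A k.castSucc * X with hV
  ext i j
  let N := U * Matrix.single i j (1 : ℝ) * V
  have hupd : ∀ M, lowerProd (Function.update A k M) (Fin.last L) * X = U * M * V := fun M => by
    rw [lowerProd_last_eq _ k, Function.update_self,
      upperProd_congr (A := A) k.succ fun i hi => Function.update_of_ne
        (fun h => by subst h; exact absurd hi (not_le.2 Fin.castSucc_lt_succ)) _ _,
      lowerProd_congr (A := A) k.castSucc fun i hi => Function.update_of_ne
        (fun h => by subst h; exact absurd hi (lt_irrefl _)) _ _, Matrix.mul_assoc]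
  have hE' : E = U * A k * V - Y := by
    rw [hE, lowerProd_last_eq A k, Matrix.mul_assoc _ _ X]
  -- Along one matrix entry the loss is a quadratic in `t`; its linear coefficient is the
  -- corresponding entry of the gradient.
  have hloss : (fun t : ℝ => loss X Y (Function.update A k (A k + t • Matrix.single i j (1 : ℝ))))
      = fun t => 1 / 2 * (frobSq E + 2 * (t * (E * Nᵀ).trace) + t ^ 2 * frobSq N) := by
    funext t
    have h1 : U * (A k + t • Matrix.single i j (1 : ℝ)) * V - Y = E + t • N := by
      simp only [hE', N, Matrix.mul_add, Matrix.add_mul, Matrix.mul_smul, Matrix.smul_mul]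
      abel
    rw [loss_eq_frobSq, hupd, h1, frobSq_add, frobSq_smul, Matrix.transpose_smul,
      Matrix.mul_smul, Matrix.trace_smul, smul_eq_mul]
  have h0 := hA k i j
  rw [hloss] at h0
  have h1 : HasDerivAt (fun t : ℝ =>
      1 / 2 * (frobSq E + 2 * (t * (E * Nᵀ).trace) + t ^ 2 * frobSq N))
      ((E * Nᵀ).trace) 0 := by
    have h := ((((hasDerivAt_id (0 : ℝ)).mul_const (E * Nᵀ).trace).const_mul 2).const_add
      (frobSq E)).add (((hasDerivAt_id (0 : ℝ)).pow 2).mul_const (frobSq N))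
    exact (h.const_mul (1 / 2 : ℝ)).congr_deriv (by simp)
  have h2 := h1.unique h0
  have h3 : (E * Nᵀ).trace = (Uᵀ * E * Vᵀ * Matrix.single j i (1 : ℝ)).trace := by
    have : E * Nᵀ = (E * Vᵀ * Matrix.single j i (1 : ℝ)) * Uᵀ := by
      simp only [N, Matrix.transpose_mul, Matrix.transpose_single, Matrix.mul_assoc]
    rw [this, Matrix.trace_mul_comm]
    simp only [Matrix.mul_assoc]
  rw [h3, Matrix.trace_mul_single, MulOpposite.op_one, one_smul] at h2
  exact h2

end Network

/-! ### Perturbing one layer together with the last -/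

section TwoLayers

variable {n m : ℕ} {d : Fin (n + 2 + 1) → ℕ}

/-- The last layer, as a matrix with rows indexed by the output. -/
def lastLayer (A : Weights d) :
    Matrix (Fin (d (Fin.last (n + 2)))) (Fin (d (Fin.last (n + 1)).castSucc)) ℝ :=
  A (Fin.last (n + 1))

/-- The last layer but one, as a matrix composable with the last layer. -/
def penultimateLayer (A : Weights d) :
    Matrix (Fin (d (Fin.last (n + 1)).castSucc)) (Fin (d (Fin.last n).castSucc.castSucc)) ℝ :=
  A (Fin.last n).castSucc

theorem upperProd_last_castSucc (A : Weights d) :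
    upperProd A (Fin.last (n + 1)).castSucc = lastLayer A :=
  (upperProd_castSucc A (Fin.last (n + 1))).trans
    ((congrArg (· * lastLayer A) (upperProd_last A)).trans (Matrix.one_mul (lastLayer A)))

/-- Multiplying the last layer from the left multiplies the upper products. -/
theorem upperProd_eq_mul {A B : Weights d}
    {R : Matrix (Fin (d (Fin.last (n + 2)))) (Fin (d (Fin.last (n + 2)))) ℝ}
    (hR : lastLayer B = R * lastLayer A) (k : Fin (n + 2))
    (h : ∀ i, k ≤ i → i ≠ Fin.last (n + 1) → B i = A i) :
    upperProd B k.castSucc = R * upperProd A k.castSucc := by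
  induction k using Fin.reverseInduction with
  -- The induction starts from the last layer alone: the empty product does not pick up the factor
  -- `R`.
  | last => rw [upperProd_last_castSucc, upperProd_last_castSucc, hR]
  | cast i ih =>
    have h1 : upperProd B i.castSucc.succ = R * upperProd A i.castSucc.succ :=
      ih fun j hj => h j (Fin.castSucc_lt_succ.le.trans hj)
    rw [upperProd_castSucc, upperProd_castSucc, h1, h _ le_rfl
      (Fin.castSucc_lt_last i).ne, Matrix.mul_assoc]

/-- Perturbing the layer `k` and the last layer. -/
def perturb (A : Weights d) (k : Fin (n + 1))
    (P : Matrix (Fin (d k.castSucc.succ)) (Fin (d k.castSucc.castSucc)) ℝ)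
    (W : Matrix (Fin (d (Fin.last (n + 2)))) (Fin (d (Fin.last (n + 1)).castSucc)) ℝ) :
    Weights d :=
  Function.update (Function.update A k.castSucc P) (Fin.last (n + 1)) W

variable (A : Weights d) (k : Fin (n + 1))
  (P : Matrix (Fin (d k.castSucc.succ)) (Fin (d k.castSucc.castSucc)) ℝ)
  (W : Matrix (Fin (d (Fin.last (n + 2)))) (Fin (d (Fin.last (n + 1)).castSucc)) ℝ)

theorem lastLayer_perturb : lastLayer (perturb A k P W) = W := Function.update_self ..

theorem perturb_castSucc : perturb A k P W k.castSucc = P := by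
  rw [perturb, Function.update_of_ne (Fin.castSucc_lt_last k).ne, Function.update_self]

theorem perturb_of_ne (i : Fin (n + 2)) (h1 : i ≠ k.castSucc) (h2 : i ≠ Fin.last (n + 1)) :
    perturb A k P W i = A i := by
  rw [perturb, Function.update_of_ne h2, Function.update_of_ne h1]

theorem perturb_self : perturb A k (A k.castSucc) (A (Fin.last (n + 1))) = A := by
  rw [perturb, Function.update_eq_self, Function.update_eq_self]

theorem lowerProd_perturb :
    lowerProd (perturb A k P W) k.castSucc.castSucc = lowerProd A k.castSucc.castSucc :=
  lowerProd_congr _ fun i hi => perturb_of_ne A k P W i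
    (fun h => by subst h; exact lt_irrefl _ hi)
    (fun h => by subst h; exact absurd (Fin.castSucc_lt_castSucc_iff.1 hi)
                   (not_lt.2 (Fin.le_last _)))

/-- A left factor on the last layer is a left factor of the whole upper product, so this
perturbation stays within the two-factor problem even when several layers lie between. -/
theorem loss_perturb_mul (X : Matrix (Fin (d 0)) (Fin m) ℝ)
    (Y : Matrix (Fin (d (Fin.last (n + 2)))) (Fin m) ℝ)
    (R : Matrix (Fin (d (Fin.last (n + 2)))) (Fin (d (Fin.last (n + 2)))) ℝ) :
    loss X Y (perturb A k P (R * lastLayer A))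
      = 1 / 2 * frobSq (R * upperProd A k.castSucc.succ * P
          * (lowerProd A k.castSucc.castSucc * X) - Y) := by
  have h : upperProd (perturb A k P (R * lastLayer A)) k.castSucc.succ
      = R * upperProd A k.castSucc.succ :=
    upperProd_eq_mul (lastLayer_perturb ..) k.succ fun i hi hl => perturb_of_ne _ _ _ _ i
      (fun h => by subst h; exact absurd hi (not_le.2 Fin.castSucc_lt_succ)) hl
  rw [loss_eq_frobSq, lowerProd_last_eq _ k.castSucc, lowerProd_perturb, perturb_castSucc,
    h, Matrix.mul_assoc _ _ X]

variable {A k P W}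

/-- Stated for arbitrary `B`, because it serves both the perturbed point and every competitor in the
minimization over the last two layers. -/
theorem loss_eq_of_last_two (X : Matrix (Fin (d 0)) (Fin m) ℝ)
    (Y : Matrix (Fin (d (Fin.last (n + 2)))) (Fin m) ℝ) {B : Weights d}
    (hB : ∀ i, i ≠ (Fin.last n).castSucc → i ≠ Fin.last (n + 1) → B i = A i) :
    loss X Y B = 1 / 2 * frobSq (lastLayer B * penultimateLayer B
        * (lowerProd A (Fin.last n).castSucc.castSucc * X) - Y) := by
  have h : lowerProd B (Fin.last n).castSucc.castSucc
      = lowerProd A (Fin.last n).castSucc.castSucc :=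
    lowerProd_congr _ fun i hi => hB i
      (fun h => by subst h; exact lt_irrefl _ hi)
      (fun h => by subst h; exact absurd (Fin.castSucc_lt_castSucc_iff.1 hi)
                     (not_lt.2 (Fin.le_last _)))
  have h2 : upperProd B (Fin.last n).castSucc.succ = lastLayer B :=
    upperProd_last_castSucc B
  rw [loss_eq_frobSq, lowerProd_last_eq _ (Fin.last n).castSucc, h, h2, Matrix.mul_assoc _ _ X]
  rfl

theorem tendsto_perturb {P : ℝ → Matrix (Fin (d k.castSucc.succ)) (Fin (d k.castSucc.castSucc)) ℝ}
    {W : ℝ → Matrix (Fin (d (Fin.last (n + 2)))) (Fin (d (Fin.last (n + 1)).castSucc)) ℝ}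
    (hP : Continuous P) (hW : Continuous W) (hP0 : P 0 = A k.castSucc)
    (hW0 : W 0 = lastLayer A) :
    Filter.Tendsto (fun t => perturb A k (P t) (W t)) (𝓝 0) (𝓝 A) := by
  have h : Continuous fun t => perturb A k (P t) (W t) :=
    (continuous_const.update k.castSucc hP).update (Fin.last (n + 1)) hW
  have h0 := h.tendsto 0
  rw [hP0, hW0] at h0
  simpa only [lastLayer, perturb_self] using h0

end TwoLayers

/-! ### Captured and missing eigenvectors -/

section SingularDirections

variable {a b : Type*} [Fintype a] [Fintype b]

/-- `W W†` is the orthogonal projection onto the column space, whose members are its fixed vectors.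
-/
theorem mem_colSpace_iff {W : Matrix a b ℝ} {x : a → ℝ} :
    x ∈ colSpace W ↔ (W * pinv W) *ᵥ x = x := by
  constructor
  · rintro ⟨y, rfl⟩
    rw [Matrix.mulVecLin_apply, Matrix.mulVec_mulVec, (pinv_spec W).mul_mul_self]
  · intro h
    exact ⟨pinv W *ᵥ x, by rw [Matrix.mulVecLin_apply, Matrix.mulVec_mulVec, h]⟩

variable [DecidableEq a]

/-- A singular direction that is not fully captured can be found orthogonal to the columns. -/
theorem exists_unit_orthogonal_eigenvector {S : Matrix a a ℝ} {W : Matrix a b ℝ} {σ : ℝ}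
    (hcomm : S * (W * pinv W) = (W * pinv W) * S) (h : captured S W σ < multOf S σ) :
    ∃ u, u ⬝ᵥ u = 1 ∧ (W * pinv W) *ᵥ u = 0 ∧ S *ᵥ u = σ • u := by
  obtain ⟨x, hxE, hxW⟩ : ∃ x ∈ eigSpace S σ, x ∉ colSpace W := by
    by_contra! hle
    rw [captured, multOf, inf_eq_right.2 hle] at h
    exact lt_irrefl _ h
  have hSx : S *ᵥ x = σ • x := by
    simpa [eigSpace, Module.End.mem_eigenspace_iff] using hxE
  set T := W * pinv W with hT
  have hT2 : T * T = T := by rw [hT, ← Matrix.mul_assoc, (pinv_spec W).mul_mul_self]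
  -- The witness is the normalized component of `x` orthogonal to the columns; it remains an
  -- eigenvector because `T` commutes with `S`.
  have hy0 : x - T *ᵥ x ≠ 0 := fun h0 => hxW (mem_colSpace_iff.2 (sub_eq_zero.1 h0).symm)
  obtain ⟨r, hr⟩ := exists_unit_smul hy0
  refine ⟨_, hr, ?_, ?_⟩
  · rw [Matrix.mulVec_smul, Matrix.mulVec_sub, Matrix.mulVec_mulVec, hT2, sub_self, smul_zero]
  · rw [Matrix.mulVec_smul, Matrix.mulVec_sub, Matrix.mulVec_mulVec, hcomm, ← Matrix.mulVec_mulVec,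
      hSx, Matrix.mulVec_smul, ← smul_sub, smul_comm]

theorem exists_unit_captured_eigenvector {S : Matrix a a ℝ} {W : Matrix a b ℝ} {σ : ℝ}
    (h : 0 < captured S W σ) :
    ∃ v, v ⬝ᵥ v = 1 ∧ (W * pinv W) *ᵥ v = v ∧ S *ᵥ v = σ • v := by
  have := Module.finrank_pos_iff.1 h
  obtain ⟨⟨x, hxW, hxE⟩, hx0⟩ := exists_ne (0 : (colSpace W ⊓ eigSpace S σ : Submodule ℝ (a → ℝ)))
  have hSx : S *ᵥ x = σ • x := by
    simpa [eigSpace, Module.End.mem_eigenspace_iff] using hxE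
  obtain ⟨r, hr⟩ := exists_unit_smul (v := x) fun h => hx0 (Subtype.ext h)
  refine ⟨_, hr, ?_, ?_⟩
  · rw [Matrix.mulVec_smul, mem_colSpace_iff.1 hxW]
  · rw [Matrix.mulVec_smul, hSx, smul_comm]

end SingularDirections

/-! ### Critical points of the network: descent and ascent -/

section Descent

variable {n m : ℕ} {d : Fin (n + 2 + 1) → ℕ} {X : Matrix (Fin (d 0)) (Fin m) ℝ}
  {Y : Matrix (Fin (d (Fin.last (n + 2)))) (Fin m) ℝ} {A : Weights d}

theorem upperProd_mul_layer_mul (A : Weights d) (X : Matrix (Fin (d 0)) (Fin m) ℝ)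
    (k : Fin (n + 2)) :
    upperProd A k.succ * A k * (lowerProd A k.castSucc * X) = lowerProd A (Fin.last (n + 2)) * X := by
  rw [lowerProd_last_eq A k, Matrix.mul_assoc _ _ X]

/-- At a critical point the network computes the projection of the target. -/
theorem IsCriticalPoint.output_eq (hA : IsCriticalPoint X Y A) (k : Fin (n + 2)) :
    lowerProd A (Fin.last (n + 2)) * X
      = upperProd A k.succ * pinv (upperProd A k.succ) * Y
        * (pinv (lowerProd A k.castSucc * X) * (lowerProd A k.castSucc * X)) := by
  have h := hA.gradient_eq_zero k
  have hM := upperProd_mul_layer_mul A X k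
  set M := lowerProd A (Fin.last (n + 2)) * X
  set W := upperProd A k.succ
  set Z := lowerProd A k.castSucc * X
  obtain ⟨hW1, -, hW3, -⟩ := pinv_spec W
  obtain ⟨hZ1, -, -, hZ4⟩ := pinv_spec Z
  -- Multiplying the gradient equation by `(W†)ᵀ` and `(Z†)ᵀ` replaces the outer factors by
  -- symmetric projections, which leave the output `M` unchanged.
  have h1 : (W * pinv W)ᵀ * (M - Y) * (pinv Z * Z)ᵀ = 0 := by
    have : (W * pinv W)ᵀ * (M - Y) * (pinv Z * Z)ᵀ
        = (pinv W)ᵀ * (Wᵀ * (M - Y) * Zᵀ) * (pinv Z)ᵀ := by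
      simp only [Matrix.transpose_mul, Matrix.mul_assoc]
    rw [this, h, Matrix.mul_zero, Matrix.zero_mul]
  rw [hW3, hZ4, Matrix.mul_sub, Matrix.sub_mul, sub_eq_zero] at h1
  rw [← h1, ← hM]
  calc W * A k * Z = (W * pinv W * W) * A k * (Z * pinv Z * Z) := by rw [hW1, hZ1]
    _ = _ := by simp only [Matrix.mul_assoc]

/-- For the last layer the upper product is empty, so stationarity holds without a left factor. -/
theorem IsCriticalPoint.residual_mul_transpose_eq_zero (hA : IsCriticalPoint X Y A) :
    (lowerProd A (Fin.last (n + 2)) * X - Y)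
      * (lowerProd A (Fin.last (n + 1)).castSucc * X)ᵀ = 0 := by
  have h := hA.gradient_eq_zero (Fin.last (n + 1))
  rw [Fin.succ_last, upperProd_last, Matrix.transpose_one] at h
  exact (congrArg (· * _) (Matrix.one_mul _)).symm.trans h

/-- At a critical point the column space of the upper product is invariant under `Σ_k`. -/
theorem IsCriticalPoint.sigmaMat_comm (hA : IsCriticalPoint X Y A) (k : Fin (n + 2)) :
    sigmaMat X Y A k.castSucc * (upperProd A k.succ * pinv (upperProd A k.succ))
      = upperProd A k.succ * pinv (upperProd A k.succ) * sigmaMat X Y A k.castSucc := by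
  have hout := hA.output_eq k
  have h0 : (lowerProd A (Fin.last (n + 2)) * X - Y) * (lowerProd A (Fin.last (n + 2)) * X)ᵀ = 0 := by
    have h := hA.residual_mul_transpose_eq_zero
    have e : lowerProd A (Fin.last (n + 2)) * X
        = lastLayer A * (lowerProd A (Fin.last (n + 1)).castSucc * X) := by
      rw [← Matrix.mul_assoc]; rfl
    rw [congrArg Matrix.transpose e, Matrix.transpose_mul, ← Matrix.mul_assoc, h, Matrix.zero_mul]
  unfold sigmaMat
  set W := upperProd A k.succ
  set Z := lowerProd A k.castSucc * X
  obtain ⟨hW1, -, hW3, -⟩ := pinv_spec W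
  obtain ⟨-, hZ2, -, hZ4⟩ := pinv_spec Z
  have hQ2 : pinv Z * Z * (pinv Z * Z) = pinv Z * Z := by rw [← Matrix.mul_assoc, hZ2]
  have hS : Y * pinv Z * Z * Yᵀ = Y * (pinv Z * Z) * Yᵀ := by
    rw [Matrix.mul_assoc Y (pinv Z) Z]
  have hSt : (Y * (pinv Z * Z) * Yᵀ)ᵀ = Y * (pinv Z * Z) * Yᵀ := by
    rw [Matrix.transpose_mul, Matrix.transpose_mul, hZ4, Matrix.transpose_transpose,
      Matrix.mul_assoc Y]
  rw [hS]
  rw [hout] at h0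
  set Q := pinv Z * Z
  set T := W * pinv W
  -- With the output equal to `T Y Q`, orthogonality of residual and output reads `T Σ T = Σ T`. The
  -- left side is symmetric, hence so is `Σ T`, which is commutation.
  have h1 : T * (Y * Q * Yᵀ) * T = Y * Q * Yᵀ * T := by
    have e1 : T * Y * Q * (T * Y * Q)ᵀ = T * (Y * (Q * Q) * Yᵀ) * T := by
      simp only [Matrix.transpose_mul, hW3, hZ4, Matrix.mul_assoc]
    have e2 : Y * (T * Y * Q)ᵀ = Y * Q * Yᵀ * T := by
      simp only [Matrix.transpose_mul, hW3, hZ4, Matrix.mul_assoc]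
    rw [Matrix.sub_mul, e1, e2, hQ2, sub_eq_zero] at h0
    exact h0
  calc Y * Q * Yᵀ * T = T * (Y * Q * Yᵀ) * T := h1.symm
    _ = (Y * Q * Yᵀ * T)ᵀ := by
      rw [← h1, Matrix.transpose_mul, Matrix.transpose_mul T, hSt, hW3]
      exact Matrix.mul_assoc _ _ _
    _ = T * (Y * Q * Yᵀ) := by rw [Matrix.transpose_mul, hSt, hW3]

/-- The deficit at `i` gives the missing direction and the positive count at `j` the captured one;
since `i < j`, the missing one has the larger eigenvalue. -/
theorem exists_descent_of_isDeepNonOptimalOrderAt {k : Fin (n + 1)}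
    (h : IsDeepNonOptimalOrderAt X Y A k) {N : Set (Weights d)} (hN : N ∈ 𝓝 A) :
    ∃ B ∈ N, (∀ i, i ≠ k.castSucc → i ≠ Fin.last (n + 1) → B i = A i) ∧
      (B (Fin.last (n + 1))).rank = (A (Fin.last (n + 1))).rank ∧ loss X Y B < loss X Y A := by
  obtain ⟨hA, r, σ, hσ, i, j, hij, hi, hj⟩ := h
  obtain ⟨u, huu, hu, hSu⟩ := exists_unit_orthogonal_eigenvector (hA.sigmaMat_comm k.castSucc) hi
  obtain ⟨v, hvv, hv, hSv⟩ := exists_unit_captured_eigenvector hj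
  have hM := upperProd_mul_layer_mul A X k.castSucc
  obtain ⟨R, P, hRc, hPc, hR0, hP0, hRu, hlt⟩ := exists_descent_of_eigenvectors
    (hM.trans (hA.output_eq k.castSucc)) (hσ.strictAnti hij) huu hvv hu hv hSu hSv
  have ht := tendsto_perturb (A := A) hPc 
    (hRc.matrix_mul (continuous_const (y := lastLayer A))) hP0
    (by rw [hR0]; exact Matrix.one_mul (lastLayer A))
  obtain ⟨t, htN, ht0⟩ := (((ht.eventually hN).filter_mono nhdsWithin_le_nhds).and
    (self_mem_nhdsWithin : {0}ᶜ ∈ 𝓝[≠] (0 : ℝ))).exists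
  refine ⟨_, htN, fun i h1 h2 => perturb_of_ne _ _ _ _ i h1 h2, ?_, ?_⟩
  · change (lastLayer (perturb A k (P t) (R t * lastLayer A))).rank = _
    rw [lastLayer_perturb]
    exact Matrix.rank_mul_eq_right_of_isUnit_det _ _ ((Matrix.isUnit_iff_isUnit_det _).1 (hRu t))
  · rw [loss_perturb_mul, loss_eq_frobSq, ← hM]
    exact mul_lt_mul_of_pos_left (hlt t ht0) (by norm_num)

theorem exists_descent_of_isDeepOptimalOrder (h : IsDeepOptimalOrder X Y A)
    {N : Set (Weights d)} (hN : N ∈ 𝓝 A) :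
    ∃ B ∈ N, (∀ i, i ≠ (Fin.last n).castSucc → i ≠ Fin.last (n + 1) → B i = A i) ∧
      (B (Fin.last (n + 1))).rank = (A (Fin.last (n + 1))).rank + 1 ∧
      loss X Y B < loss X Y A := by
  obtain ⟨hA, hmin, hrank, -⟩ := h
  let W := lastLayer A
  let P := penultimateLayer A
  let Z := lowerProd A (Fin.last n).castSucc.castSucc * X
  have hPZ : P * Z = lowerProd A (Fin.last (n + 1)).castSucc * X := by
    rw [← Matrix.mul_assoc]; rfl
  have hM : W * P * Z = lowerProd A (Fin.last (n + 2)) * X := by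
    rw [Matrix.mul_assoc, hPZ, ← Matrix.mul_assoc]; rfl
  have hlossA : loss X Y A = 1 / 2 * frobSq (W * P * Z - Y) := by rw [loss_eq_frobSq, hM]
  have hU : upperProd A (Fin.last n).castSucc.succ = W := upperProd_last_castSucc A
  -- `M ↦ ‖M Z - Y‖²` is convex, so if its gradient vanished at `W P`, no choice of the last two
  -- layers could do better.
  have hne : (W * P * Z - Y) * Zᵀ ≠ 0 := by
    intro h0
    apply hmin
    intro B hB
    show loss X Y A ≤ loss X Y B
    have hBA : loss X Y B = 1 / 2 * frobSq (lastLayer B * penultimateLayer B * Z - Y) :=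
      loss_eq_of_last_two X Y hB
    rw [hlossA, hBA]
    have e : lastLayer B * penultimateLayer B * Z - Y = (W * P * Z - Y)
        + (lastLayer B * penultimateLayer B - W * P) * Z := by
      rw [Matrix.sub_mul]; abel
    have e2 : ((W * P * Z - Y)
        * ((lastLayer B * penultimateLayer B - W * P) * Z)ᵀ).trace = 0 := by
      rw [Matrix.transpose_mul, ← Matrix.mul_assoc, h0, Matrix.zero_mul, Matrix.trace_zero]
    rw [e, frobSq_add, e2]
    have := frobSq_nonneg ((lastLayer B * penultimateLayer B - W * P) * Z)
    linarith
  have hgW : Wᵀ * (W * P * Z - Y) * Zᵀ = 0 := by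
    have := hA.gradient_eq_zero (Fin.last n).castSucc
    rwa [hU, ← hM] at this
  have hgP : (W * P * Z - Y) * (P * Z)ᵀ = 0 := by
    rw [hM, hPZ]; exact hA.residual_mul_transpose_eq_zero
  obtain ⟨W', P', hWc, hPc, hW0, hP0, hr, hlt⟩ := exists_descent_of_rank_lt
    -- The bound by `d_{ℓ-1}`, the number of columns of `A_ℓ`, is what provides a kernel vector.
    ((hrank.trans_le (min_le_right _ _)).trans_eq (Fintype.card_fin _).symm) hgW hgP hne
  have ht := tendsto_perturb (A := A) (k := Fin.last n) hPc hWc hP0 hW0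
  obtain ⟨t, ⟨htN, ht0⟩, htlt⟩ := (((ht.eventually hN).filter_mono nhdsWithin_le_nhds).and
    (self_mem_nhdsWithin : Set.Ioi 0 ∈ 𝓝[>] (0 : ℝ))).and hlt |>.exists
  refine ⟨_, htN, fun i h1 h2 => perturb_of_ne _ _ _ _ i h1 h2, ?_, ?_⟩
  · change (lastLayer (perturb A (Fin.last n) (P' t) (W' t))).rank = _
    rw [lastLayer_perturb]
    exact hr t (ne_of_gt ht0)
  · rw [loss_eq_of_last_two X Y (perturb_of_ne A (Fin.last n) (P' t) (W' t)), lastLayer_perturb,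
      penultimateLayer, perturb_castSucc, hlossA]
    exact mul_lt_mul_of_pos_left htlt (by norm_num)

/-- Scaling the last layer by `1 + t` scales the output `M`; the loss is then quadratic in `t` with
leading coefficient `½ ‖M‖² > 0`. For the sign of `t` that makes the linear term nonnegative it
strictly increases, so no criticality is needed. -/
theorem exists_ascent_of_output_ne_zero (h : lowerProd A (Fin.last (n + 2)) * X ≠ 0)
    {N : Set (Weights d)} (hN : N ∈ 𝓝 A) :
    ∃ B ∈ N, (∀ i, i ≠ Fin.last (n + 1) → B i = A i) ∧ loss X Y A < loss X Y B := by
  let B : ℝ → Weights d := fun t =>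
    Function.update A (Fin.last (n + 1)) ((1 + t) • A (Fin.last (n + 1)))
  set M := lowerProd A (Fin.last (n + 2)) * X with hM
  have hB : ∀ t, loss X Y (B t) = 1 / 2 * frobSq (M - Y)
      + t * ((M - Y) * Mᵀ).trace + t ^ 2 * (1 / 2 * frobSq M) := by
    intro t
    have h1 : lowerProd (B t) (Fin.last (n + 2)) * X = (1 + t) • M := by
      have h2 : lowerProd (B t) (Fin.last (n + 1)).castSucc
          = lowerProd A (Fin.last (n + 1)).castSucc :=
        lowerProd_congr _ fun i hi => Function.update_of_ne
          (fun h => by subst h; exact lt_irrefl _ hi) _ _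
      rw [hM, ← Fin.succ_last, lowerProd_succ, lowerProd_succ, h2]
      simp [B, Matrix.smul_mul]
    rw [loss_eq_frobSq, h1, show (1 + t) • M - Y = (M - Y) + t • M by module, frobSq_add,
      frobSq_smul, Matrix.transpose_smul, Matrix.mul_smul, Matrix.trace_smul, smul_eq_mul]
    ring
  have hBc : Continuous B := continuous_const.update _ (by fun_prop)
  have hB0 : B 0 = A := by simp [B]
  have ht : Filter.Tendsto B (𝓝 0) (𝓝 A) := by simpa [hB0] using hBc.tendsto 0
  have hneg : Filter.Tendsto (fun t => B (-t)) (𝓝 0) (𝓝 A) := by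
    simpa [hB0, Function.comp_def] using (hBc.comp continuous_neg).tendsto 0
  obtain ⟨t, ⟨h1, h2⟩, ht0⟩ := ((((ht.eventually hN).and (hneg.eventually hN)).filter_mono
    nhdsWithin_le_nhds).and (self_mem_nhdsWithin : {0}ᶜ ∈ 𝓝[≠] (0 : ℝ))).exists
  have hA : loss X Y A = 1 / 2 * frobSq (M - Y) := rfl
  have hpos : 0 < t ^ 2 * (1 / 2 * frobSq M) :=
    mul_pos (sq_pos_of_ne_zero ht0) (mul_pos (by norm_num) (frobSq_pos h))
  rcases le_total 0 (t * ((M - Y) * Mᵀ).trace) with hs | hs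
  · exact ⟨B t, h1, fun i hi => Function.update_of_ne hi _ _, by rw [hB, hA]; linarith⟩
  · refine ⟨B (-t), h2, fun i hi => Function.update_of_ne hi _ _, ?_⟩
    rw [hB, hA, neg_sq]
    linarith

theorem not_isLocalMin_of_order (h : IsDeepNonOptimalOrder X Y A ∨ IsDeepOptimalOrder X Y A) :
    ¬ IsLocalMin (loss X Y) A := by
  intro hmin
  rcases h with ⟨k, h⟩ | h
  -- Local minimality says that the points with loss at least that of `A` form a neighborhood; the
  -- descent result is applied to it.
  · obtain ⟨B, hB, -, -, hlt⟩ := exists_descent_of_isDeepNonOptimalOrderAt h hmin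
    exact absurd hB (not_le.2 hlt)
  · obtain ⟨B, hB, -, -, hlt⟩ := exists_descent_of_isDeepOptimalOrder h hmin
    exact absurd hB (not_le.2 hlt)

end Descent

/-! ### The theorem -/

theorem theorem4 {n m : ℕ} (d : Fin (n + 2 + 1) → ℕ)
    (X : Matrix (Fin (d 0)) (Fin m) ℝ) (Y : Matrix (Fin (d (Fin.last (n + 2)))) (Fin m) ℝ) :
    -- non-optimal order: only the layers `A_{k+1}` and `A_ℓ` are perturbed
    (∀ (A : Weights d) (k : Fin (n + 1)), IsDeepNonOptimalOrderAt X Y A k →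
      ∀ N ∈ 𝓝 A, ∃ B ∈ N,
        (∀ i, i ≠ k.castSucc → i ≠ Fin.last (n + 1) → B i = A i) ∧
        (B (Fin.last (n + 1))).rank = (A (Fin.last (n + 1))).rank ∧
        loss X Y B < loss X Y A) ∧
    -- optimal order: only the layers `A_{ℓ-1}` and `A_ℓ` are perturbed
    (∀ A : Weights d, IsDeepOptimalOrder X Y A →
      ∀ N ∈ 𝓝 A, ∃ B ∈ N,
        (∀ i, i ≠ (Fin.last n).castSucc → i ≠ Fin.last (n + 1) → B i = A i) ∧
        (B (Fin.last (n + 1))).rank = (A (Fin.last (n + 1))).rank + 1 ∧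
        loss X Y B < loss X Y A) ∧
    -- nonzero output: only the layer `A_ℓ` is perturbed
    (∀ A : Weights d, lowerProd A (Fin.last (n + 2)) * X ≠ 0 →
      ∀ N ∈ 𝓝 A, ∃ B ∈ N,
        (∀ i, i ≠ Fin.last (n + 1) → B i = A i) ∧
        loss X Y A < loss X Y B) ∧
    -- local minima of the two types are global minima
    (∀ A : Weights d, IsDeepNonOptimalOrder X Y A ∨ IsDeepOptimalOrder X Y A →
      IsLocalMin (loss X Y) A → ∀ B : Weights d, loss X Y A ≤ loss X Y B) ∧
    -- points of the two types with nonzero output are saddle points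
    (∀ A : Weights d, IsDeepNonOptimalOrder X Y A ∨ IsDeepOptimalOrder X Y A →
      lowerProd A (Fin.last (n + 2)) * X ≠ 0 → IsSaddlePoint X Y A) := by
  refine ⟨fun A k h N hN => exists_descent_of_isDeepNonOptimalOrderAt h hN,
    fun A h N hN => exists_descent_of_isDeepOptimalOrder h hN,
    fun A h N hN => exists_ascent_of_output_ne_zero h hN,
    -- This claim holds vacuously: by the descent results no point of either type is a local
    -- minimum.
    fun A h hmin => absurd hmin (not_isLocalMin_of_order h),
    fun A h hne => ⟨?_, not_isLocalMin_of_order h, fun hmax => ?_⟩⟩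
  · rcases h with ⟨k, h⟩ | h
    · exact h.1
    · exact h.1
  · obtain ⟨B, hB, -, hlt⟩ := exists_ascent_of_output_ne_zero hne hmax
    exact absurd hB (not_le.2 hlt)
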